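/- Let $n\ge 3$ and let $\mathcal P=\{x\in\mathbb R^n : x^n=1\}$. A $C^2$ convex cone in $\mathbb R^n$ is a set of the form $$K=\{tp : p\in\gamma,\ t>0\}\subset\mathbb R^n,$$ where $\gamma\subset\mathcal P$ is a $C^2$-smooth, strictly convex, closed hypersurface of $\mathcal P$ (the boundary, relative to $\mathcal P$, of a compact strictly convex set with nonempty interior) whose second fundamental form is nondegenerate at every point. A billiard trajectory inside $K$ moves in straight lines with unit speed in the open region bounded by $K$ (the interior of the convex hull of $K$), and when it hits $K$ at a point its velocity is reflected in the tangent hyperplane of $K$ at that point. Theorem. For every $n\ge 3$ there exists a $C^2$ convex cone $K\subset\mathbb R^n$ whose billiard admits a trajectory with infinitely many reflections in finite time; that is, there are points $p_0,p_1,p_2,\dots\in K$, times $\tau_0<\tau_1<\tau_2<\cdots$ bounded above, and unit vectors $v_0,v_1,\dots$ such that for all $k\ge 0$: $p_{k+1}=p_k+(\tau_{k+1}-\tau_k)v_k$, the open segment from $p_k$ to $p_{k+1}$ lies in the open region bounded by $K$, and $v_{k+1}$ is the reflection of $v_k$ in the tangent hyperplane of $K$ at $p_{k+1}$. -/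

import Mathlib

/-- `f` is a `C²` local defining function of the set `S` at the point `p ∈ S`: it is `C²` near `p`,
its differential at `p` does not vanish, and `S` coincides with the zero set of `f` near `p`. -/
structure IsC2DefiningFunctionAt {d : ℕ} (S : Set (EuclideanSpace ℝ (Fin d)))
    (f : EuclideanSpace ℝ (Fin d) → ℝ) (p : EuclideanSpace ℝ (Fin d)) : Prop where
  mem : p ∈ S
  contDiffAt : ContDiffAt ℝ 2 f p
  gradient_ne_zero : gradient f p ≠ 0
  eventually_mem_iff : ∀ᶠ x in nhds p, x ∈ S ↔ f x = 0

/-- The tangent hyperplane at `p` of a hypersurface with local defining function `f` at `p`,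
i.e. the kernel of the differential of `f` at `p`. It depends only on the hypersurface and `p`. -/
noncomputable def tangentHyperplane {d : ℕ} (f : EuclideanSpace ℝ (Fin d) → ℝ)
    (p : EuclideanSpace ℝ (Fin d)) : Submodule ℝ (EuclideanSpace ℝ (Fin d)) :=
  (Submodule.span ℝ {gradient f p})ᗮ

/-- The second fundamental form at `p` (with respect to the unit normal `-∇f / ‖∇f‖`) of a
hypersurface with local defining function `f` at `p`: the Hessian of `f` divided by `‖∇f‖`,
to be evaluated on tangent vectors. Up to sign it depends only on the hypersurface and `p`. -/
noncomputable def secondFundamentalForm {d : ℕ} (f : EuclideanSpace ℝ (Fin d) → ℝ)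
    (p v w : EuclideanSpace ℝ (Fin d)) : ℝ :=
  fderiv ℝ (fderiv ℝ f) p v w / ‖gradient f p‖

/-- `Γ` is a `C²` embedded hypersurface of `ℝᵈ` (without boundary). -/
def IsC2Hypersurface {d : ℕ} (Γ : Set (EuclideanSpace ℝ (Fin d))) : Prop :=
  ∀ p ∈ Γ, ∃ f, IsC2DefiningFunctionAt Γ f p

/-- The second fundamental form of `Γ` is a nondegenerate bilinear form on the tangent space at
every point of `Γ`. -/
def HasNondegenerateSecondFundamentalForm {d : ℕ} (Γ : Set (EuclideanSpace ℝ (Fin d))) : Prop :=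
  ∀ p ∈ Γ, ∃ f, IsC2DefiningFunctionAt Γ f p ∧
    ∀ v ∈ tangentHyperplane f p,
      (∀ w ∈ tangentHyperplane f p, secondFundamentalForm f p v w = 0) → v = 0

/-- `Γ` is a strictly convex closed hypersurface: it is the boundary of a compact strictly convex
set with nonempty interior. -/
def IsStrictlyConvexClosed {d : ℕ} (Γ : Set (EuclideanSpace ℝ (Fin d))) : Prop :=
  ∃ B : Set (EuclideanSpace ℝ (Fin d)),
    IsCompact B ∧ StrictConvex ℝ B ∧ (interior B).Nonempty ∧ Γ = frontier B

/-- The isometric identification `y ↦ (y, 1)` of `ℝᵐ` with the hyperplane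
`{x | the last coordinate of x is 1}` of `ℝᵐ⁺¹`. -/
noncomputable def toHyperplane {m : ℕ} (y : EuclideanSpace ℝ (Fin m)) :
    EuclideanSpace ℝ (Fin (m + 1)) :=
  WithLp.toLp 2 (Fin.snoc (α := fun _ => ℝ) (fun i => y i) 1)

/-- The cone `K = {t p | p ∈ γ, t > 0}` over `γ`. -/
def coneOver {d : ℕ} (γ : Set (EuclideanSpace ℝ (Fin d))) : Set (EuclideanSpace ℝ (Fin d)) :=
  {x | ∃ t : ℝ, 0 < t ∧ ∃ p ∈ γ, x = t • p}

/-- `K ⊆ ℝᵐ⁺¹` is a `C²` convex cone: the cone over a `C²` strictly convex closed hypersurface,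
with nondegenerate second fundamental form, of the hyperplane where the last coordinate is 1. -/
def IsC2ConvexCone {m : ℕ} (K : Set (EuclideanSpace ℝ (Fin (m + 1)))) : Prop :=
  ∃ Γ : Set (EuclideanSpace ℝ (Fin m)),
    IsC2Hypersurface Γ ∧ IsStrictlyConvexClosed Γ ∧ HasNondegenerateSecondFundamentalForm Γ ∧
      K = coneOver (toHyperplane '' Γ)

/-- The billiard reflection law at the point `p` of the hypersurface `K`: the outgoing velocity `v'`
is the mirror image of the incoming velocity `v` in the tangent hyperplane of `K` at `p`. -/
def IsReflectedAt {d : ℕ} (K : Set (EuclideanSpace ℝ (Fin d)))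
    (p v v' : EuclideanSpace ℝ (Fin d)) : Prop :=
  ∃ f, IsC2DefiningFunctionAt K f p ∧ v' = (tangentHyperplane f p).reflection v

/-- A billiard trajectory inside the convex cone `K` with infinitely many reflections. The particle
leaves the point `p 0` of `K` at time `τ 0`; at the times `τ 1 < τ 2 < ...` it is reflected at the
points `p 1, p 2, ...` of `K`. Between the times `τ k` and `τ (k + 1)` it moves in a straight line
with unit velocity `v k` in the open region bounded by `K`. -/
structure IsInfiniteBilliardTrajectory {d : ℕ} (K : Set (EuclideanSpace ℝ (Fin d)))
    (τ : ℕ → ℝ) (p v : ℕ → EuclideanSpace ℝ (Fin d)) : Prop where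
  mem : ∀ k, p k ∈ K
  time_strictMono : StrictMono τ
  norm_velocity : ∀ k, ‖v k‖ = 1
  motion : ∀ k, p (k + 1) = p k + (τ (k + 1) - τ k) • v k
  inside : ∀ k, ∀ s ∈ Set.Ioo (τ k) (τ (k + 1)),
    p k + (s - τ k) • v k ∈ interior (convexHull ℝ K)
  reflection : ∀ k, IsReflectedAt K (p (k + 1)) (v k) (v (k + 1))

/-!
The distance of the lines of a billiard trajectory from the apex of a cone is conserved, since all
tangent planes contain the apex. Unfolded into a plane, the trajectory is therefore a straight line
at a fixed distance from the apex, and infinitely many reflections happen in finite time as soon as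
the total angle that the trajectory sweeps, seen from the apex, is less than `π`. So it suffices to
find a table for which the sum of these angles converges.

The trajectory is prescribed first and the table is bent to fit it. The trajectory has its vertices
on the rays through the points with angles `-1 / (k + 1)`, where `k` is large, of the unit circle in
a plane at height 1 (`circleVertex`). A path through these rays, straight after unfolding, exists for
any such sequence of points (`circleVertex_add`, `arrival_add`). Its reflection at a vertex determines
the tangent plane that the cone must have there (`departure_sub_arrival`), and this plane differs from
that of the round cone by a small amount `kink k`. The two sides adjacent to a vertex have nearly the
same length, with ratio tending to 1, so `kink k` is small compared to the distance from the
neighbouring vertices (`tendsto_kink_div`). This is exactly what is needed for a `C²`-small function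
`E` that vanishes at all the vertices and has the derivatives `kink k` there: a sum of bumps with
disjoint supports whose second derivatives tend to zero (`exists_contDiff_two_interpolation`).

The body `‖y‖² - 1 + E (y 0) ≤ 0` is a `C²`-small perturbation of the unit ball, hence strictly convex
with nondegenerate second fundamental form. It is symmetric in all coordinates but the first, so a
trajectory over the plane of the first two coordinates stays over this plane, and the same planar
construction works in every dimension.
-/

open Filter Topology

/-! ### Sums of functions with disjoint supports -/

/-- Since at most one term is nonzero at every point, `ε k → 0` suffices here, although `∑ ε k` may
diverge and the Weierstrass test fail. -/
theorem tendstoUniformly_sum_of_disjoint {φ : ℕ → ℝ → ℝ} {ε : ℕ → ℝ} (hε : Tendsto ε atTop (𝓝 0))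
    (hb : ∀ k x, |φ k x| ≤ ε k) (hd : ∀ x, ∃ k₀, ∀ k, k ≠ k₀ → φ k x = 0) :
    TendstoUniformly (fun n x => ∑ k ∈ Finset.range n, φ k x) (fun x => ∑' k, φ k x) atTop := by
  rw [Metric.tendstoUniformly_iff]
  intro δ hδ
  obtain ⟨N, hN⟩ := eventually_atTop.1 (hε.eventually (gt_mem_nhds hδ))
  filter_upwards [eventually_ge_atTop N] with n hn x
  obtain ⟨k₀, hk⟩ := hd x
  rw [tsum_eq_single k₀ (fun k h => hk k h), Real.dist_eq]
  by_cases h : k₀ < n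
  · rw [Finset.sum_eq_single k₀ (fun k _ h => hk k h)
      (fun h' => absurd (Finset.mem_range.2 h) h')]
    simpa using hδ
  · rw [Finset.sum_eq_zero (fun k hk' => hk k
      (fun h' => h (h' ▸ Finset.mem_range.1 hk'))), sub_zero]
    exact (hb k₀ x).trans_lt (hN k₀ (hn.trans (not_lt.1 h)))

theorem hasDerivAt_tsum_of_disjoint {φ φ' : ℕ → ℝ → ℝ} {ε : ℕ → ℝ}
    (hε : Tendsto ε atTop (𝓝 0)) (hφ : ∀ k x, HasDerivAt (φ k) (φ' k x) x)
    (hb : ∀ k x, |φ' k x| ≤ ε k)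
    (hd : ∀ x, ∃ k₀, ∀ k, k ≠ k₀ → φ k x = 0 ∧ φ' k x = 0) (x : ℝ) :
    HasDerivAt (fun x => ∑' k, φ k x) (∑' k, φ' k x) x := by
  refine hasDerivAt_of_tendstoUniformly
    (tendstoUniformly_sum_of_disjoint hε hb fun x => ?_) (f := fun n x => ∑ k ∈ Finset.range n, φ k x)
    (Eventually.of_forall fun n y => HasDerivAt.fun_sum fun k _ => hφ k y) (fun y => ?_) x
  · obtain ⟨k₀, h⟩ := hd x
    exact ⟨k₀, fun k hk => (h k hk).2⟩
  · obtain ⟨k₀, h⟩ := hd y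
    have hs : Summable fun k => φ k y :=
      summable_of_ne_finset_zero (s := {k₀}) fun k hk => (h k (by simpa using hk)).1
    exact hs.hasSum.tendsto_sum_nat

/-- A fixed smooth profile `η` supported in `[-1, 1]` with `η 0 = 0` and `η' 0 = 1`, given together
with its first two derivatives and a common bound for all three. -/
theorem exists_unit_kink : ∃ (η₀ η₁ η₂ : ℝ → ℝ) (C : ℝ), 0 < C ∧
    (∀ t, HasDerivAt η₀ (η₁ t) t) ∧ (∀ t, HasDerivAt η₁ (η₂ t) t) ∧ Continuous η₂ ∧
    (∀ t, 1 ≤ |t| → η₀ t = 0 ∧ η₁ t = 0 ∧ η₂ t = 0) ∧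
    (∀ t, |η₀ t| ≤ C ∧ |η₁ t| ≤ C ∧ |η₂ t| ≤ C) ∧ η₀ 0 = 0 ∧ η₁ 0 = 1 := by
  let b : ContDiffBump (0 : ℝ) := ⟨1 / 4, 1 / 2, by norm_num, by norm_num⟩
  let η : ℝ → ℝ := fun t => t * b t
  have hη : ContDiff ℝ 2 η := contDiff_id.mul b.contDiff
  have h1 : ContDiff ℝ 1 (deriv η) := ((contDiff_succ_iff_deriv (n := 1)).1 hη).2.2
  have h2 : Continuous (deriv (deriv η)) := h1.continuous_deriv le_rfl
  have hz : ∀ t : ℝ, 1 ≤ |t| → η =ᶠ[𝓝 t] 0 := fun t ht => by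
    have : {s : ℝ | 1 / 2 < |s|} ∈ 𝓝 t :=
      (isOpen_lt continuous_const continuous_abs).mem_nhds
        (show (1 : ℝ) / 2 < |t| by linarith)
    filter_upwards [this] with s hs
    have : b s = 0 := b.zero_of_le_dist (by
      rw [Real.dist_0_eq_abs]
      exact le_of_lt hs)
    simp [η, this]
  have hz1 : ∀ t : ℝ, 1 ≤ |t| → η t = 0 ∧ deriv η t = 0 ∧ deriv (deriv η) t = 0 := fun t ht => by
    have e0 := hz t ht
    have e1 : deriv η =ᶠ[𝓝 t] 0 := e0.deriv.trans (by simp)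
    have e2 : deriv (deriv η) =ᶠ[𝓝 t] 0 := e1.deriv.trans (by simp)
    exact ⟨e0.eq_of_nhds, e1.eq_of_nhds, e2.eq_of_nhds⟩
  have bd : ∀ f : ℝ → ℝ, Continuous f → (∀ t, 1 ≤ |t| → f t = 0) → ∃ C, 0 ≤ C ∧ ∀ t, |f t| ≤ C := by
    intro f hf h0
    obtain ⟨C, hC⟩ := isCompact_Icc.exists_bound_of_continuousOn (s := Set.Icc (-1 : ℝ) 1)
      hf.continuousOn
    refine ⟨|C|, abs_nonneg _, fun t => ?_⟩
    by_cases ht : |t| ≤ 1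
    · exact (hC t (abs_le.1 ht)).trans (le_abs_self _)
    · rw [h0 t (not_le.1 ht).le]; simp
  obtain ⟨C₀, p₀, b₀⟩ := bd η hη.continuous fun t ht => (hz1 t ht).1
  obtain ⟨C₁, p₁, b₁⟩ := bd _ h1.continuous fun t ht => (hz1 t ht).2.1
  obtain ⟨C₂, p₂, b₂⟩ := bd _ h2 fun t ht => (hz1 t ht).2.2
  refine ⟨η, deriv η, deriv (deriv η), C₀ + C₁ + C₂ + 1, by positivity,
    fun t => (hη.differentiable (by norm_num) t).hasDerivAt,
    fun t => (h1.differentiable (by norm_num) t).hasDerivAt, h2, hz1,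
    fun t => ⟨by linarith [b₀ t], by linarith [b₁ t], by linarith [b₂ t]⟩, by simp [η], ?_⟩
  have hb : HasDerivAt b 0 0 := by
    have := b.eventuallyEq_one
    exact (hasDerivAt_const (0 : ℝ) (1 : ℝ)).congr_of_eventuallyEq this
  have := ((hasDerivAt_id (0 : ℝ)).mul hb).deriv
  have hb0 : b 0 = 1 := b.eventuallyEq_one.eq_of_nhds
  have e : η = id * ⇑b := rfl
  rw [e, this]
  simp [hb0]

/-- A `C²`-small function with prescribed first-order data `E (x k) = 0`, `E' (x k) = e k`: it exists
whenever the `x k` are separated by intervals of radius `ρ k` and `e k / ρ k → 0`, which is exactly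
what makes the second derivative continuous at the accumulation point of the `x k`. After
discarding finitely many `k` the function is as small as desired. -/
theorem exists_contDiff_two_interpolation {x ρ e : ℕ → ℝ} (hρ : ∀ k, 0 < ρ k) (hρ1 : ∀ k, ρ k ≤ 1)
    (hx : ∀ i j, i < j → x i + ρ i ≤ x j - ρ j)
    (he : Tendsto (fun k => e k / ρ k) atTop (𝓝 0)) {δ : ℝ} (hδ : 0 < δ) :
    ∃ N : ℕ, ∀ M, N ≤ M → ∃ E : ℝ → ℝ, ContDiff ℝ 2 E ∧ (∀ t, |E t| ≤ δ) ∧ (∀ t, |deriv E t| ≤ δ) ∧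
      (∀ t, |deriv (deriv E) t| ≤ δ) ∧ ∀ k, E (x (k + M)) = 0 ∧ deriv E (x (k + M)) = e (k + M) := by
  obtain ⟨η₀, η₁, η₂, C, hC, hd0, hd1, hc2, hz, hbd, h00, h10⟩ := exists_unit_kink
  have hε : Tendsto (fun k => |e k / ρ k| * C) atTop (𝓝 0) := by
    simpa using he.abs.mul_const C
  obtain ⟨N, hN⟩ := eventually_atTop.1 (hε.eventually (gt_mem_nhds hδ))
  refine ⟨N, fun M hM => ?_⟩
  have hεM : Tendsto (fun k => |e (k + M) / ρ (k + M)| * C) atTop (𝓝 0) :=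
    hε.comp (tendsto_add_atTop_nat M)
  let u : ℕ → ℝ → ℝ := fun k t => (t - x (k + M)) / ρ (k + M)
  let φ₀ : ℕ → ℝ → ℝ := fun k t => e (k + M) * ρ (k + M) * η₀ (u k t)
  let φ₁ : ℕ → ℝ → ℝ := fun k t => e (k + M) * η₁ (u k t)
  let φ₂ : ℕ → ℝ → ℝ := fun k t => e (k + M) / ρ (k + M) * η₂ (u k t)
  have hu : ∀ k t, HasDerivAt (u k) (1 / ρ (k + M)) t := fun k t =>
    ((hasDerivAt_id t).sub_const _).div_const _
  have hφ0 : ∀ k t, HasDerivAt (φ₀ k) (φ₁ k t) t := fun k t => by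
    have := ((hd0 (u k t)).comp t (hu k t)).const_mul (e (k + M) * ρ (k + M))
    have hne := (hρ (k + M)).ne'
    refine this.congr_deriv ?_
    change _ = e (k + M) * _
    field_simp
  have hφ1 : ∀ k t, HasDerivAt (φ₁ k) (φ₂ k t) t := fun k t => by
    have := ((hd1 (u k t)).comp t (hu k t)).const_mul (e (k + M))
    refine this.congr_deriv ?_
    change _ = e (k + M) / _ * _
    ring
  have hsep : ∀ t, ∃ k₀, ∀ k, k ≠ k₀ → φ₀ k t = 0 ∧ φ₁ k t = 0 ∧ φ₂ k t = 0 := by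
    intro t
    have key : ∀ k, 1 ≤ |u k t| → φ₀ k t = 0 ∧ φ₁ k t = 0 ∧ φ₂ k t = 0 := fun k hk => by
      obtain ⟨h0, h1, h2⟩ := hz _ hk
      simp [φ₀, φ₁, φ₂, h0, h1, h2]
    by_cases h : ∃ k₀, |u k₀ t| < 1
    · obtain ⟨k₀, hk₀⟩ := h
      refine ⟨k₀, fun k hk => key k ?_⟩
      by_contra! hlt
      simp only [u, abs_div, abs_of_pos (hρ _), div_lt_one (hρ _), abs_lt] at hk₀ hlt
      rcases lt_or_gt_of_ne hk with h | h
      · have := hx (k + M) (k₀ + M) (by omega)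
        linarith [hk₀.1, hlt.2]
      · have := hx (k₀ + M) (k + M) (by omega)
        linarith [hk₀.2, hlt.1]
    · push Not at h
      exact ⟨0, fun k _ => key k (h k)⟩
  have hb2 : ∀ k t, |φ₂ k t| ≤ |e (k + M) / ρ (k + M)| * C := fun k t => by
    simp only [φ₂, abs_mul]
    exact mul_le_mul_of_nonneg_left (hbd _).2.2 (abs_nonneg _)
  have hle : ∀ k, |e k| ≤ |e k / ρ k| := fun k => by
    rw [abs_div, abs_of_pos (hρ k), le_div_iff₀ (hρ k)]
    exact mul_le_of_le_one_right (abs_nonneg _) (hρ1 k)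
  have hb1 : ∀ k t, |φ₁ k t| ≤ |e (k + M) / ρ (k + M)| * C := fun k t => by
    simp only [φ₁, abs_mul]
    exact mul_le_mul (hle _) (hbd _).2.1 (abs_nonneg _) (abs_nonneg _)
  have hb0 : ∀ k t, |φ₀ k t| ≤ |e (k + M) / ρ (k + M)| * C := fun k t => by
    simp only [φ₀, abs_mul]
    refine mul_le_mul (le_trans ?_ (hle _)) (hbd _).1 (abs_nonneg _) (abs_nonneg _)
    rw [abs_of_pos (hρ _)]
    exact mul_le_of_le_one_right (abs_nonneg _) (hρ1 _)
  have hE0 : ∀ t, HasDerivAt (fun t => ∑' k, φ₀ k t) (∑' k, φ₁ k t) t :=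
    hasDerivAt_tsum_of_disjoint hεM hφ0 hb1 fun t => (hsep t).imp fun k₀ h k hk =>
      ⟨(h k hk).1, (h k hk).2.1⟩
  have hE1 : ∀ t, HasDerivAt (fun t => ∑' k, φ₁ k t) (∑' k, φ₂ k t) t :=
    hasDerivAt_tsum_of_disjoint hεM hφ1 hb2 fun t => (hsep t).imp fun k₀ h k hk => (h k hk).2
  have hE2 : Continuous (fun t => ∑' k, φ₂ k t) := by
    refine (tendstoUniformly_sum_of_disjoint hεM hb2 fun t => (hsep t).imp fun k₀ h k hk =>
      (h k hk).2.2).continuous (Frequently.of_forall fun n => ?_)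
    refine continuous_finsetSum _ fun k _ => continuous_const.mul (hc2.comp ?_)
    exact (continuous_id.sub continuous_const).div_const _
  have hD0 : deriv (fun t => ∑' k, φ₀ k t) = fun t => ∑' k, φ₁ k t := funext fun t => (hE0 t).deriv
  have hD1 : deriv (fun t => ∑' k, φ₁ k t) = fun t => ∑' k, φ₂ k t := funext fun t => (hE1 t).deriv
  have hsmall : ∀ k, |e (k + M) / ρ (k + M)| * C ≤ δ := fun k => (hN _ (by omega)).le
  refine ⟨fun t => ∑' k, φ₀ k t, ?_, fun t => ?_, fun t => ?_, fun t => ?_, fun k => ?_⟩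
  · refine (contDiff_succ_iff_deriv (n := 1)).2 ⟨fun t => (hE0 t).differentiableAt, by simp, ?_⟩
    rw [hD0]
    refine contDiff_one_iff_deriv.2 ⟨fun t => (hE1 t).differentiableAt, ?_⟩
    rwa [hD1]
  · obtain ⟨k₀, h⟩ := hsep t
    simp only
    rw [tsum_eq_single k₀ fun k hk => (h k hk).1]
    exact (hb0 _ _).trans (hsmall _)
  · obtain ⟨k₀, h⟩ := hsep t
    rw [hD0]
    simp only
    rw [tsum_eq_single k₀ fun k hk => (h k hk).2.1]
    exact (hb1 _ _).trans (hsmall _)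
  · obtain ⟨k₀, h⟩ := hsep t
    rw [hD0, hD1]
    simp only
    rw [tsum_eq_single k₀ fun k hk => (h k hk).2.2]
    exact (hb2 _ _).trans (hsmall _)
  · have hk : ∀ j, j ≠ k → φ₀ j (x (k + M)) = 0 ∧ φ₁ j (x (k + M)) = 0 := by
      intro j hj
      have : 1 ≤ |u j (x (k + M))| := by
        simp only [u, abs_div, abs_of_pos (hρ _), one_le_div (hρ _)]
        have := hρ (k + M)
        rcases lt_or_gt_of_ne hj with h | h
        · have := hx (j + M) (k + M) (by omega)
          exact le_abs.2 (Or.inl (by linarith))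
        · have := hx (k + M) (j + M) (by omega)
          exact le_abs.2 (Or.inr (by linarith))
      obtain ⟨h0, h1, -⟩ := hz _ this
      simp [φ₀, φ₁, h0, h1]
    rw [hD0]
    simp only
    rw [tsum_eq_single k fun j hj => (hk j hj).1, tsum_eq_single k fun j hj => (hk j hj).2]
    simp [φ₀, φ₁, u, h00, h10]

/-! ### Vertices on the unit circle and the perturbation of the circle -/

/-- With `T` the unit tangent of the unit circle and `R` the unit radius at one of its points, the
vector of length `√2` orthogonal to `(R, 1)` that points towards the point of the circle at angular
distance `2 β` is `a (-R, 1) + 2 b (T, 0)`, where `a` is `radialWeight β` and `b` is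
`tangentialWeight β`. -/
noncomputable def radialWeight (β : ℝ) : ℝ := Real.sin β / √(1 + Real.cos β ^ 2)

/-- The weight of the tangent direction; see `radialWeight`. -/
noncomputable def tangentialWeight (β : ℝ) : ℝ := Real.cos β / √(1 + Real.cos β ^ 2)

/-- The angle, seen from the apex, between two points of the unit circle in the plane at height 1
whose angular distance on the circle is `2 β`. -/
noncomputable def arcAngle (β : ℝ) : ℝ := Real.arccos (Real.cos β ^ 2)

theorem sqrt_one_add_cos_sq_pos (β : ℝ) : 0 < √(1 + Real.cos β ^ 2) := by positivity

theorem radialWeight_sq_add (β : ℝ) : radialWeight β ^ 2 + 2 * tangentialWeight β ^ 2 = 1 := by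
  have h : √(1 + Real.cos β ^ 2) ^ 2 = 1 + Real.cos β ^ 2 := Real.sq_sqrt (by positivity)
  have h0 := (sqrt_one_add_cos_sq_pos β).ne'
  rw [radialWeight, tangentialWeight, div_pow, div_pow, h]
  have : 1 + Real.cos β ^ 2 ≠ 0 := by positivity
  field_simp
  linarith [Real.sin_sq_add_cos_sq β]

theorem cos_arcAngle (β : ℝ) : Real.cos (arcAngle β) = Real.cos β ^ 2 :=
  Real.cos_arccos (by linarith [sq_nonneg (Real.cos β)]) (Real.cos_sq_le_one β)

theorem sin_arcAngle {β : ℝ} (h : 0 ≤ Real.sin β) :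
    Real.sin (arcAngle β) = Real.sin β * √(1 + Real.cos β ^ 2) := by
  rw [arcAngle, Real.sin_arccos, show 1 - (Real.cos β ^ 2) ^ 2 =
    Real.sin β ^ 2 * (1 + Real.cos β ^ 2) by rw [Real.sin_sq]; ring,
    Real.sqrt_mul (sq_nonneg _), Real.sqrt_sq h]

theorem arcAngle_pos {β : ℝ} (h0 : 0 < β) (h1 : β < Real.pi) : 0 < arcAngle β := by
  rw [arcAngle, Real.arccos_pos]
  nlinarith [Real.sin_sq_add_cos_sq β, Real.sin_pos_of_pos_of_lt_pi h0 h1]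

theorem arcAngle_le {β : ℝ} (h0 : 0 ≤ β) (h1 : β ≤ Real.pi) : arcAngle β ≤ 3 * β := by
  have hs := Real.sin_nonneg_of_nonneg_of_le_pi h0 h1
  have h2 : arcAngle β ≤ Real.pi / 2 := Real.arccos_le_pi_div_two.2 (sq_nonneg _)
  have h3 := Real.mul_le_sin (Real.arccos_nonneg (Real.cos β ^ 2)) h2
  change 2 / Real.pi * arcAngle β ≤ Real.sin (arcAngle β) at h3
  rw [sin_arcAngle hs, div_mul_eq_mul_div, div_le_iff₀ Real.pi_pos] at h3
  have h4 : √(1 + Real.cos β ^ 2) ≤ 3 / 2 := by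
    rw [Real.sqrt_le_left (by norm_num)]
    linarith [Real.cos_sq_le_one β]
  have h5 := Real.sin_le h0
  have h6 : Real.sin β * √(1 + Real.cos β ^ 2) ≤ β * (3 / 2) := by gcongr
  nlinarith [Real.pi_lt_four, Real.pi_pos]

/-- The angular positions on the unit circle of the rays that carry the reflection points. Any
sequence increasing to a limit whose consecutive steps have ratios tending to 1 would do. -/
noncomputable def vertexAngle (k : ℕ) : ℝ := -1 / (k + 1)

/-- Half the difference of consecutive vertex angles; see `halfStep_eq`. -/
noncomputable def halfStep (k : ℕ) : ℝ := 1 / (2 * ((k + 1) * (k + 2)))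

theorem halfStep_eq (k : ℕ) : halfStep k = (vertexAngle (k + 1) - vertexAngle k) / 2 := by
  have h1 : (k : ℝ) + 1 ≠ 0 := by positivity
  have h2 : (k : ℝ) + 2 ≠ 0 := by positivity
  rw [halfStep, vertexAngle, vertexAngle]
  push_cast
  rw [show (k : ℝ) + 1 + 1 = k + 2 by ring]
  field_simp
  ring

theorem halfStep_pos (k : ℕ) : 0 < halfStep k := by unfold halfStep; positivity

theorem halfStep_le (k : ℕ) : halfStep k ≤ 1 / 4 := by
  unfold halfStep
  gcongr
  have : (0 : ℝ) ≤ k := by positivity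
  nlinarith

theorem halfStep_antitone : Antitone halfStep := by
  refine antitone_nat_of_succ_le fun k => ?_
  unfold halfStep
  push_cast
  gcongr <;> linarith

theorem vertexAngle_mem (k : ℕ) : -1 ≤ vertexAngle k ∧ vertexAngle k ≤ 0 := by
  unfold vertexAngle
  have : (0 : ℝ) < (k : ℝ) + 1 := by positivity
  constructor
  · rw [le_div_iff₀ this]; linarith [(Nat.cast_nonneg k : (0 : ℝ) ≤ k)]
  · exact div_nonpos_of_nonpos_of_nonneg (by norm_num) this.le

theorem tendsto_vertexAngle : Tendsto vertexAngle atTop (𝓝 0) := by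
  have := (tendsto_one_div_add_atTop_nhds_zero_nat (𝕜 := ℝ)).neg
  rw [neg_zero] at this
  exact this.congr fun k => by rw [vertexAngle, neg_div]

theorem tendsto_halfStep : Tendsto halfStep atTop (𝓝 0) := by
  have := ((tendsto_vertexAngle.comp (tendsto_add_atTop_nat 1)).sub tendsto_vertexAngle).div_const 2
  simp only [sub_zero, zero_div] at this
  exact this.congr fun k => (halfStep_eq k).symm

theorem tendsto_halfStep_ratio :
    Tendsto (fun k => halfStep k / halfStep (k + 1)) atTop (𝓝 1) := by
  have h : Tendsto (fun k : ℕ => 1 + 2 * (1 / ((k : ℝ) + 1))) atTop (𝓝 (1 + 2 * 0)) :=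
    (tendsto_one_div_add_atTop_nhds_zero_nat.const_mul 2).const_add 1
  rw [mul_zero, add_zero] at h
  refine h.congr fun k => ?_
  have h1 : (k : ℝ) + 1 ≠ 0 := by positivity
  have h2 : (k : ℝ) + 2 ≠ 0 := by positivity
  have h3 : (k : ℝ) + 3 ≠ 0 := by positivity
  simp only [halfStep]
  push_cast
  rw [show (k : ℝ) + 1 + 1 = k + 2 by ring, show (k : ℝ) + 1 + 2 = k + 3 by ring]
  field_simp
  ring

/-- The value that the derivative of the profile `E` must have at `sin α`, with `α` the angle of the
vertex number `k + 1`, for the body `‖y‖² - 1 + E (y 0) ≤ 0` to reflect the side of the trajectory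
before this vertex into the side after it; see `kink_spec`. -/
noncomputable def kink (k : ℕ) : ℝ :=
  2 * (radialWeight (halfStep (k + 1)) - radialWeight (halfStep k)) /
    ((tangentialWeight (halfStep (k + 1)) + tangentialWeight (halfStep k)) *
        Real.cos (vertexAngle (k + 1)) -
      (radialWeight (halfStep (k + 1)) - radialWeight (halfStep k)) *
        Real.sin (vertexAngle (k + 1)))

theorem tangentialWeight_pos {β : ℝ} (h : |β| ≤ 1) : 0 < tangentialWeight β :=
  div_pos (Real.cos_pos_of_le_one h) (sqrt_one_add_cos_sq_pos β)

theorem radialWeight_pos {β : ℝ} (h0 : 0 < β) (h1 : β ≤ 1) : 0 < radialWeight β :=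
  div_pos (Real.sin_pos_of_pos_of_le_one h0 h1) (sqrt_one_add_cos_sq_pos β)

theorem continuous_radialWeight : Continuous radialWeight :=
  Real.continuous_sin.div (by fun_prop) fun β => (sqrt_one_add_cos_sq_pos β).ne'

theorem continuous_tangentialWeight : Continuous tangentialWeight :=
  Real.continuous_cos.div (by fun_prop) fun β => (sqrt_one_add_cos_sq_pos β).ne'

theorem tendsto_radialWeight_div : Tendsto (fun k => radialWeight (halfStep k) / halfStep k) atTop
    (𝓝 (1 / √2)) := by
  have h1 : Tendsto (fun k => Real.sin (halfStep k) / halfStep k) atTop (𝓝 1) := by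
    have := (hasDerivAt_iff_tendsto_slope.1 (Real.hasDerivAt_sin 0))
    rw [Real.cos_zero] at this
    have h2 : Tendsto halfStep atTop (𝓝[≠] 0) := tendsto_nhdsWithin_iff.2
      ⟨tendsto_halfStep, Eventually.of_forall fun k => (halfStep_pos k).ne'⟩
    refine (this.comp h2).congr fun k => ?_
    simp [slope_def_field]
  have h2 : Tendsto (fun k => √(1 + Real.cos (halfStep k) ^ 2)) atTop (𝓝 √2) := by
    have : Continuous fun β => √(1 + Real.cos β ^ 2) := by fun_prop
    have := (this.tendsto 0).comp tendsto_halfStep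
    rw [Real.cos_zero] at this
    norm_num at this
    exact this
  refine (h1.div h2 (by positivity)).congr fun k => ?_
  simp only [radialWeight, Pi.div_apply]
  ring

/-- The kinks are small compared with the steps. This is where the ratios of the
steps enter: they make the second derivative of the profile continuous at the limit point. -/
theorem tendsto_kink_div : Tendsto (fun k => kink k / (halfStep (k + 1) / 4)) atTop (𝓝 0) := by
  have a1 := tendsto_radialWeight_div.comp (tendsto_add_atTop_nat 1)
  have a0 := tendsto_radialWeight_div.mul tendsto_halfStep_ratio
  have w : Tendsto (fun k => radialWeight (halfStep k)) atTop (𝓝 0) := by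
    have := (continuous_radialWeight.tendsto 0).comp tendsto_halfStep
    rwa [show radialWeight 0 = 0 by simp [radialWeight]] at this
  have w1 := w.comp (tendsto_add_atTop_nat 1)
  have t : Tendsto (fun k => tangentialWeight (halfStep k)) atTop (𝓝 (tangentialWeight 0)) :=
    (continuous_tangentialWeight.tendsto 0).comp tendsto_halfStep
  have t1 := t.comp (tendsto_add_atTop_nat 1)
  have v := tendsto_vertexAngle.comp (tendsto_add_atTop_nat 1)
  have c := (Real.continuous_cos.tendsto 0).comp v
  have s := (Real.continuous_sin.tendsto 0).comp v
  have hd := ((t1.add t).mul c).sub ((w1.sub w).mul s)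
  have hn := ((a1.sub a0).const_mul 8)
  have h0 := tangentialWeight_pos (β := 0) (by simp)
  have := hn.div hd (by
    rw [Real.cos_zero]; simp only [sub_self, zero_mul, sub_zero, mul_one]; positivity)
  simp only [mul_one, sub_self, mul_zero, zero_div] at this
  refine this.congr fun k => ?_
  have e0 := (halfStep_pos k).ne'
  have e1 := (halfStep_pos (k + 1)).ne'
  simp only [Pi.div_apply, Function.comp, kink]
  have : 8 * (radialWeight (halfStep (k + 1)) / halfStep (k + 1) -
      radialWeight (halfStep k) / halfStep k * (halfStep k / halfStep (k + 1))) =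
      2 * (radialWeight (halfStep (k + 1)) - radialWeight (halfStep k)) * 4 /
        halfStep (k + 1) := by
    field_simp
    ring
  rw [this]
  ring

theorem radialWeight_le_tangentialWeight {β : ℝ} (h0 : 0 ≤ β) (h1 : β ≤ 1 / 4) :
    radialWeight β ≤ tangentialWeight β / 3 := by
  rw [radialWeight, tangentialWeight, div_right_comm]
  gcongr
  nlinarith [Real.sin_le h0, Real.one_sub_sq_div_two_le_cos (x := β)]

/-- Up to a factor, this says that the normal of the cone at the vertex number `k + 1` bisects the
two sides of the trajectory there; see `departure_sub_arrival`. The denominator of `kink` is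
positive because the steps are short and `-1 ≤ vertexAngle (k + 1)`. -/
theorem kink_spec (k : ℕ) :
    (2 + kink k * Real.sin (vertexAngle (k + 1))) *
        (radialWeight (halfStep (k + 1)) - radialWeight (halfStep k)) =
      kink k * Real.cos (vertexAngle (k + 1)) *
        (tangentialWeight (halfStep (k + 1)) + tangentialWeight (halfStep k)) := by
  have hden : 0 < (tangentialWeight (halfStep (k + 1)) + tangentialWeight (halfStep k)) *
        Real.cos (vertexAngle (k + 1)) -
      (radialWeight (halfStep (k + 1)) - radialWeight (halfStep k)) *
        Real.sin (vertexAngle (k + 1)) := by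
    have p0 := halfStep_pos k
    have p1 := halfStep_pos (k + 1)
    have l0 := halfStep_le k
    have l1 := halfStep_le (k + 1)
    have a0 := radialWeight_pos p0 (by linarith)
    have a1 := radialWeight_pos p1 (by linarith)
    have c0 := radialWeight_le_tangentialWeight p0.le l0
    have c1 := radialWeight_le_tangentialWeight p1.le l1
    have hα := vertexAngle_mem (k + 1)
    have hc : 1 / 2 ≤ Real.cos (vertexAngle (k + 1)) := by
      nlinarith [Real.one_sub_sq_div_two_le_cos (x := vertexAngle (k + 1))]
    have hs : |Real.sin (vertexAngle (k + 1))| ≤ 1 := Real.abs_sin_le_one _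
    generalize radialWeight (halfStep (k + 1)) = a at *
    generalize radialWeight (halfStep k) = a' at *
    generalize tangentialWeight (halfStep (k + 1)) = b at *
    generalize tangentialWeight (halfStep k) = b' at *
    have hd : |a - a'| ≤ (b + b') / 3 := abs_le.2 ⟨by linarith, by linarith⟩
    have h1 : (a - a') * Real.sin (vertexAngle (k + 1)) ≤ (b + b') / 3 :=
      calc _ ≤ |a - a'| * |Real.sin (vertexAngle (k + 1))| := by
            rw [← abs_mul]; exact le_abs_self _
        _ ≤ (b + b') / 3 * 1 := mul_le_mul hd hs (abs_nonneg _) (by linarith)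
        _ = _ := mul_one _
    have h2 : (b + b') * (1 / 2) ≤ (b + b') * Real.cos (vertexAngle (k + 1)) := by
      have : 0 ≤ b + b' := by linarith
      gcongr
    linarith
  have : kink k * _ = _ := div_mul_cancel₀ _ hden.ne'
  linarith

theorem halfStep_le_sin_sub_sin (k : ℕ) :
    halfStep k / 2 ≤ Real.sin (vertexAngle (k + 1)) - Real.sin (vertexAngle k) := by
  have h1 := vertexAngle_mem k
  have h2 := vertexAngle_mem (k + 1)
  have h3 := halfStep_pos k
  have h4 := halfStep_le k
  rw [Real.sin_sub_sin, ← halfStep_eq]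
  have hc : 1 / 2 ≤ Real.cos ((vertexAngle (k + 1) + vertexAngle k) / 2) := by
    refine le_trans ?_ Real.one_sub_sq_div_two_le_cos
    nlinarith
  have hs : halfStep k / 2 ≤ Real.sin (halfStep k) := by
    have := Real.sin_gt_sub_cube h3
    nlinarith [mul_pos h3 h3]
  nlinarith

theorem sin_vertexAngle_separated {i j : ℕ} (h : i < j) :
    Real.sin (vertexAngle i) + halfStep i / 4 ≤ Real.sin (vertexAngle j) - halfStep j / 4 := by
  induction j, h using Nat.le_induction with
  | base =>
    have h1 := halfStep_le_sin_sub_sin i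
    have h2 := halfStep_antitone i.le_succ
    change halfStep (i + 1) ≤ halfStep i at h2
    linarith
  | succ j _ ih =>
    have h1 := halfStep_le_sin_sub_sin j
    have h2 := halfStep_antitone j.le_succ
    change halfStep (j + 1) ≤ halfStep j at h2
    have h3 := halfStep_pos j
    linarith

/-- The perturbation of the unit circle: a small `C²` function `E` that vanishes at the vertices and has
the reflecting derivatives there. -/
theorem exists_profile : ∃ (N : ℕ) (E : ℝ → ℝ), ContDiff ℝ 2 E ∧ (∀ t, |E t| ≤ 1 / 2) ∧
    (∀ t, |deriv E t| ≤ 1 / 2) ∧ (∀ t, |deriv (deriv E) t| ≤ 1 / 2) ∧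
    (∀ k, E (Real.sin (vertexAngle (N + k))) = 0) ∧
    (∀ k, deriv E (Real.sin (vertexAngle (N + k + 1))) = kink (N + k)) ∧
    ∀ k, vertexAngle (N + k) - vertexAngle N ≤ 1 / 2 := by
  obtain ⟨N, hN⟩ := exists_contDiff_two_interpolation
    (x := fun k => Real.sin (vertexAngle (k + 1))) (ρ := fun k => halfStep (k + 1) / 4) (e := kink)
    (fun k => by have := halfStep_pos (k + 1); positivity)
    (fun k => by have := halfStep_le (k + 1); linarith)
    (fun i j h => sin_vertexAngle_separated (by omega)) tendsto_kink_div
    (δ := 1 / 2) (by norm_num)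
  obtain ⟨E, hE, h0, h1, h2, h3⟩ := hN (N + 1) (by omega)
  refine ⟨N + 2, E, hE, h0, h1, h2, fun k => ?_, fun k => ?_, fun k => ?_⟩
  · have := (h3 k).1
    rwa [show k + (N + 1) + 1 = N + 2 + k by ring] at this
  · have := (h3 (k + 1)).2
    rwa [show k + 1 + (N + 1) + 1 = N + 2 + k + 1 by ring,
      show k + 1 + (N + 1) = N + 2 + k by ring] at this
  · have h1 := (vertexAngle_mem (N + 2 + k)).2
    have h2 : -(1 / 2) ≤ vertexAngle (N + 2) := by
      rw [vertexAngle, neg_div, neg_le_neg_iff]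
      push_cast
      gcongr
      linarith [(Nat.cast_nonneg N : (0 : ℝ) ≤ N)]
    linarith

/-! ### The convex body over a small profile -/

/-- A `C²` function that is small, together with its first two derivatives. -/
structure IsSmallProfile (E : ℝ → ℝ) : Prop where
  contDiff : ContDiff ℝ 2 E
  abs_apply_le : ∀ t, |E t| ≤ 1 / 2
  abs_deriv_le : ∀ t, |deriv E t| ≤ 1 / 2
  abs_deriv_deriv_le : ∀ t, |deriv (deriv E) t| ≤ 1 / 2

/-- The defining function `‖y‖² - 1 + E (y 0)` of a convex body close to the unit ball. -/
noncomputable def tableFunction {n : ℕ} (E : ℝ → ℝ) (y : EuclideanSpace ℝ (Fin (n + 1))) : ℝ :=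
  ‖y‖ ^ 2 - 1 + E (y 0)

theorem sq_apply_le_norm_sq {n : ℕ} (y : EuclideanSpace ℝ (Fin n)) (i : Fin n) :
    y i ^ 2 ≤ ‖y‖ ^ 2 := by
  rw [EuclideanSpace.real_norm_sq_eq]
  exact Finset.single_le_sum (f := fun i => y i ^ 2) (fun i _ => sq_nonneg _) (Finset.mem_univ i)

namespace IsSmallProfile

variable {n : ℕ} {E : ℝ → ℝ} (hE : IsSmallProfile E)
include hE

theorem hasDerivAt (t : ℝ) : HasDerivAt E (deriv E t) t :=
  (hE.contDiff.differentiable (by norm_num) t).hasDerivAt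

theorem contDiff_deriv : ContDiff ℝ 1 (deriv E) :=
  ((contDiff_succ_iff_deriv (n := 1)).1 hE.contDiff).2.2

theorem hasDerivAt_deriv (t : ℝ) : HasDerivAt (deriv E) (deriv (deriv E) t) t :=
  (hE.contDiff_deriv.differentiable (by norm_num) t).hasDerivAt

theorem contDiff_tableFunction : ContDiff ℝ 2 (tableFunction (n := n) E) :=
  ((contDiff_norm_sq ℝ).sub contDiff_const).add
    (hE.contDiff.comp (EuclideanSpace.proj (𝕜 := ℝ) (0 : Fin (n + 1))).contDiff)

theorem fderiv_tableFunction : fderiv ℝ (tableFunction (n := n) E) = fun y =>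
    (2 : ℝ) • innerSL ℝ y + deriv E (y 0) • EuclideanSpace.proj (𝕜 := ℝ) (0 : Fin (n + 1)) := by
  funext y
  have h1 : HasFDerivAt (fun y : EuclideanSpace ℝ (Fin (n + 1)) => ‖y‖ ^ 2 - 1)
      ((2 : ℝ) • innerSL ℝ y) y := by
    have := (hasStrictFDerivAt_norm_sq y).hasFDerivAt.sub_const 1
    rwa [← Nat.cast_smul_eq_nsmul ℝ, Nat.cast_ofNat] at this
  exact (h1.add ((hE.hasDerivAt (y 0)).comp_hasFDerivAt y
    (EuclideanSpace.proj (𝕜 := ℝ) (0 : Fin (n + 1))).hasFDerivAt)).fderiv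

theorem fderiv_tableFunction_apply (y v : EuclideanSpace ℝ (Fin (n + 1))) :
    fderiv ℝ (tableFunction E) y v = 2 * inner ℝ y v + deriv E (y 0) * v 0 := by
  rw [hE.fderiv_tableFunction]
  simp

theorem fderiv_fderiv_tableFunction_apply (y v w : EuclideanSpace ℝ (Fin (n + 1))) :
    fderiv ℝ (fderiv ℝ (tableFunction E)) y v w =
      2 * inner ℝ v w + deriv (deriv E) (y 0) * v 0 * w 0 := by
  rw [hE.fderiv_tableFunction]
  have h1 : HasFDerivAt (fun y : EuclideanSpace ℝ (Fin (n + 1)) => (2 : ℝ) • innerSL ℝ y)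
      ((2 : ℝ) • innerSL ℝ) y :=
    ((2 : ℝ) • (innerSL ℝ : EuclideanSpace ℝ (Fin (n + 1)) →L[ℝ] _)).hasFDerivAt
  have h2 := ((hE.hasDerivAt_deriv (y 0)).comp_hasFDerivAt y
    (EuclideanSpace.proj (𝕜 := ℝ) (0 : Fin (n + 1))).hasFDerivAt).smul_const
      (EuclideanSpace.proj (𝕜 := ℝ) (0 : Fin (n + 1)))
  have h3 := (h1.add h2).fderiv
  have h4 := congrArg (fun L => L v w) h3
  refine h4.trans ?_
  simp
  rfl

theorem norm_sq_sub_le (y : EuclideanSpace ℝ (Fin (n + 1))) :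
    ‖y‖ ^ 2 - 3 / 2 ≤ tableFunction E y := by
  have := neg_le_of_abs_le (hE.abs_apply_le (y 0))
  rw [tableFunction]
  linarith

theorem tableFunction_zero_neg : tableFunction E (0 : EuclideanSpace ℝ (Fin (n + 1))) < 0 := by
  have := le_of_abs_le (hE.abs_apply_le 0)
  simp only [tableFunction, norm_zero, PiLp.zero_apply]
  linarith

theorem gradient_tableFunction_ne_zero {y : EuclideanSpace ℝ (Fin (n + 1))}
    (hy : tableFunction E y = 0) : gradient (tableFunction E) y ≠ 0 := by
  intro h
  have h0 : fderiv ℝ (tableFunction E) y = 0 := by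
    simpa [gradient] using h
  have h1 := hE.fderiv_tableFunction_apply y y
  rw [h0, real_inner_self_eq_norm_sq] at h1
  simp only [_root_.zero_apply] at h1
  have h2 := abs_le.1 (hE.abs_apply_le (y 0))
  have h3 := abs_le.1 (hE.abs_deriv_le (y 0))
  have h4 := sq_apply_le_norm_sq y 0
  have h5 : deriv E (y 0) ^ 2 ≤ 1 / 4 := by nlinarith
  rw [tableFunction] at hy
  nlinarith [sq_nonneg (deriv E (y 0) + y 0)]

theorem convexOn_add_sq : ConvexOn ℝ Set.univ fun t => E t + t ^ 2 / 2 := by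
  have h1 : ∀ t, HasDerivAt (fun t => E t + t ^ 2 / 2) (deriv E t + t) t := fun t =>
    ((hE.hasDerivAt t).add ((hasDerivAt_pow 2 t).div_const 2)).congr_deriv (by simp)
  have h2 : ∀ t, HasDerivAt (fun t => deriv E t + t) (deriv (deriv E) t + 1) t := fun t =>
    (hE.hasDerivAt_deriv t).add (hasDerivAt_id t)
  have e1 : deriv (fun t => E t + t ^ 2 / 2) = fun t => deriv E t + t := funext fun t => (h1 t).deriv
  refine convexOn_univ_of_deriv2_nonneg (fun t => (h1 t).differentiableAt) ?_ fun t => ?_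
  · rw [e1]; exact fun t => (h2 t).differentiableAt
  · simp only [Function.iterate_succ, Function.iterate_zero, Function.comp, id]
    rw [e1, (h2 t).deriv]
    linarith [neg_le_of_abs_le (hE.abs_deriv_deriv_le t)]

theorem strictConvexOn_tableFunction :
    StrictConvexOn ℝ Set.univ (tableFunction (n := n) E) := by
  refine ⟨convex_univ, fun x _ y _ hxy a b ha hb hab => ?_⟩
  have h1 := hE.convexOn_add_sq.2 (Set.mem_univ (x 0)) (Set.mem_univ (y 0)) ha.le hb.le hab
  have h2 : ‖a • x + b • y‖ ^ 2 = a * ‖x‖ ^ 2 + b * ‖y‖ ^ 2 - a * b * ‖x - y‖ ^ 2 := by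
    rw [norm_add_sq_real, norm_sub_sq_real, norm_smul, norm_smul, inner_smul_left, inner_smul_right,
      Real.norm_of_nonneg ha.le, Real.norm_of_nonneg hb.le]
    obtain rfl : b = 1 - a := by linarith
    simp only [conj_trivial]
    ring
  have h3 := sq_apply_le_norm_sq (x - y) 0
  have h4 : 0 < ‖x - y‖ := norm_pos_iff.2 (sub_ne_zero.2 hxy)
  simp only [tableFunction, h2, smul_eq_mul, PiLp.add_apply, PiLp.smul_apply,
    PiLp.sub_apply] at h1 h3 ⊢
  have h5 : 0 < a * b * ‖x - y‖ ^ 2 := by positivity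
  have h6 : a * b * (x 0 - y 0) ^ 2 ≤ a * b * ‖x - y‖ ^ 2 := by gcongr
  obtain rfl : b = 1 - a := by linarith
  nlinarith

theorem isOpen_tableFunction_neg :
    IsOpen {y : EuclideanSpace ℝ (Fin (n + 1)) | tableFunction E y < 0} :=
  isOpen_lt hE.contDiff_tableFunction.continuous continuous_const

theorem tableFunction_neg_subset_interior :
    {y : EuclideanSpace ℝ (Fin (n + 1)) | tableFunction E y < 0} ⊆
      interior {y | tableFunction E y ≤ 0} :=
  interior_maximal (fun _ h => le_of_lt (show tableFunction E _ < 0 from h))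
    hE.isOpen_tableFunction_neg

theorem frontier_tableFunction_nonpos :
    frontier {y : EuclideanSpace ℝ (Fin (n + 1)) | tableFunction E y ≤ 0} =
      {y | tableFunction E y = 0} := by
  have hcl : IsClosed {y : EuclideanSpace ℝ (Fin (n + 1)) | tableFunction E y ≤ 0} :=
    isClosed_le hE.contDiff_tableFunction.continuous continuous_const
  rw [hcl.frontier_eq]
  ext y
  simp only [Set.mem_sdiff, Set.mem_ofPred_eq]
  constructor
  · rintro ⟨h1, h2⟩
    by_contra h
    exact h2 (hE.tableFunction_neg_subset_interior (lt_of_le_of_ne h1 h))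
  · intro h
    refine ⟨h.le, fun hi => ?_⟩
    have hc : Tendsto (fun s : ℝ => s • y) (𝓝[>] 1) (𝓝 y) := by
      have : Continuous fun s : ℝ => s • y := by fun_prop
      simpa using (this.tendsto 1).mono_left nhdsWithin_le_nhds
    obtain ⟨s, hs, h1⟩ := ((hc.eventually (mem_interior_iff_mem_nhds.1 hi)).and
      self_mem_nhdsWithin).exists
    change 1 < s at h1
    have hy : s • y ≠ 0 := by
      intro h0
      rcases smul_eq_zero.1 h0 with h0 | h0
      · linarith
      · rw [h0] at h
        exact hE.tableFunction_zero_neg.ne h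
    have hs0 : s ≠ 0 := by linarith
    have hs1 : s⁻¹ < 1 := inv_lt_one_of_one_lt₀ h1
    have h2 := hE.strictConvexOn_tableFunction.2 (Set.mem_univ (s • y)) (Set.mem_univ 0) hy
      (show (0 : ℝ) < s⁻¹ by positivity) (show (0 : ℝ) < 1 - s⁻¹ by linarith) (by ring)
    rw [smul_zero, add_zero, smul_smul, inv_mul_cancel₀ hs0, one_smul, h, smul_eq_mul,
      smul_eq_mul] at h2
    have h3 : s⁻¹ * tableFunction E (s • y) ≤ 0 :=
      mul_nonpos_of_nonneg_of_nonpos (by positivity) hs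
    have h4 : (1 - s⁻¹) * tableFunction E (0 : EuclideanSpace ℝ (Fin (n + 1))) ≤ 0 :=
      mul_nonpos_of_nonneg_of_nonpos (by linarith) hE.tableFunction_zero_neg.le
    linarith

theorem isC2DefiningFunctionAt_tableFunction {p : EuclideanSpace ℝ (Fin (n + 1))}
    (hp : tableFunction E p = 0) :
    IsC2DefiningFunctionAt {y | tableFunction E y = 0} (tableFunction E) p :=
  ⟨hp, hE.contDiff_tableFunction.contDiffAt, hE.gradient_tableFunction_ne_zero hp,
    Eventually.of_forall fun _ => Iff.rfl⟩

theorem isStrictlyConvexClosed :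
    IsStrictlyConvexClosed {y : EuclideanSpace ℝ (Fin (n + 1)) | tableFunction E y = 0} := by
  refine ⟨{y | tableFunction E y ≤ 0}, ?_, ?_, ?_, hE.frontier_tableFunction_nonpos.symm⟩
  · refine Metric.isCompact_of_isClosed_isBounded
      (isClosed_le hE.contDiff_tableFunction.continuous continuous_const)
      ((Metric.isBounded_iff_subset_closedBall 0).2 ⟨2, fun y hy => ?_⟩)
    have h1 := hE.norm_sq_sub_le y
    change tableFunction E y ≤ 0 at hy
    rw [mem_closedBall_zero_iff]
    nlinarith [norm_nonneg y]
  · intro x hx y hy hxy a b ha hb hab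
    refine hE.tableFunction_neg_subset_interior ?_
    refine (hE.strictConvexOn_tableFunction.2 (Set.mem_univ x) (Set.mem_univ y) hxy ha hb hab).trans_le
      ?_
    change tableFunction E x ≤ 0 at hx
    change tableFunction E y ≤ 0 at hy
    simp only [smul_eq_mul]
    nlinarith
  · exact ⟨0, hE.tableFunction_neg_subset_interior hE.tableFunction_zero_neg⟩

theorem hasNondegenerateSecondFundamentalForm : HasNondegenerateSecondFundamentalForm
    {y : EuclideanSpace ℝ (Fin (n + 1)) | tableFunction E y = 0} := by
  intro p hp
  refine ⟨_, hE.isC2DefiningFunctionAt_tableFunction hp, fun v hv h => ?_⟩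
  have h1 := h v hv
  rw [secondFundamentalForm, div_eq_zero_iff, or_iff_left
    (norm_ne_zero_iff.2 (hE.gradient_tableFunction_ne_zero hp)),
    hE.fderiv_fderiv_tableFunction_apply, real_inner_self_eq_norm_sq] at h1
  have h2 := sq_apply_le_norm_sq v 0
  have h3 := neg_le_of_abs_le (hE.abs_deriv_deriv_le (p 0))
  have h4 : -(1 / 2) * v 0 ^ 2 ≤ deriv (deriv E) (p 0) * v 0 ^ 2 := by gcongr
  have h5 : ‖v‖ ^ 2 = 0 := by nlinarith [sq_nonneg ‖v‖]
  simpa using h5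

theorem isC2ConvexCone : IsC2ConvexCone
    (coneOver (toHyperplane '' {y : EuclideanSpace ℝ (Fin (n + 1)) | tableFunction E y = 0})) :=
  ⟨_, fun _ hp => ⟨_, hE.isC2DefiningFunctionAt_tableFunction hp⟩, hE.isStrictlyConvexClosed,
    hE.hasNondegenerateSecondFundamentalForm, rfl⟩

/-- Every ray from an interior point of the body hits its boundary. -/
theorem exists_pos_tableFunction_eq_zero {y u : EuclideanSpace ℝ (Fin (n + 1))}
    (hy : tableFunction E y < 0) (hu : ‖u‖ = 1) : ∃ s : ℝ, 0 < s ∧ tableFunction E (y + s • u) = 0 := by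
  have hc : Continuous fun s : ℝ => tableFunction E (y + s • u) :=
    hE.contDiff_tableFunction.continuous.comp (by fun_prop)
  have hb : 0 ≤ tableFunction E (y + (‖y‖ + 2) • u) := by
    refine le_trans ?_ (hE.norm_sq_sub_le _)
    have h1 : 2 ≤ ‖y + (‖y‖ + 2) • u‖ := by
      have := norm_sub_le (y + (‖y‖ + 2) • u) y
      rw [add_sub_cancel_left, norm_smul, hu, mul_one, Real.norm_of_nonneg (by positivity)] at this
      linarith
    nlinarith
  obtain ⟨s, hs, h0⟩ := intermediate_value_Icc (by positivity : (0 : ℝ) ≤ ‖y‖ + 2) hc.continuousOn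
    (show (0 : ℝ) ∈ Set.Icc _ _ from ⟨by simpa using hy.le, hb⟩)
  refine ⟨s, lt_of_le_of_ne hs.1 ?_, h0⟩
  rintro rfl
  simp at h0
  linarith

theorem mem_convexHull_of_tableFunction_neg {y : EuclideanSpace ℝ (Fin (n + 1))}
    (hy : tableFunction E y < 0) :
    y ∈ convexHull ℝ {y : EuclideanSpace ℝ (Fin (n + 1)) | tableFunction E y = 0} := by
  have hu : ‖EuclideanSpace.single (0 : Fin (n + 1)) (1 : ℝ)‖ = 1 := by simp
  obtain ⟨s, hs, h1⟩ := hE.exists_pos_tableFunction_eq_zero hy hu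
  obtain ⟨t, ht, h2⟩ := hE.exists_pos_tableFunction_eq_zero hy ((norm_neg _).trans hu)
  refine segment_subset_convexHull (show _ ∈ {y | tableFunction E y = 0} from h1)
    (show _ ∈ {y | tableFunction E y = 0} from h2) ?_
  refine ⟨t / (s + t), s / (s + t), by positivity, by positivity, by field_simp; ring, ?_⟩
  have : s + t ≠ 0 := by positivity
  generalize EuclideanSpace.single (0 : Fin (n + 1)) (1 : ℝ) = u
  match_scalars
  · field_simp
    ring
  · field_simp
    ring

end IsSmallProfile

/-! ### The cone over the body -/

@[simp]
theorem toHyperplane_castSucc {m : ℕ} (y : EuclideanSpace ℝ (Fin m)) (i : Fin m) :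
    toHyperplane y i.castSucc = y i := by
  simp [toHyperplane]

@[simp]
theorem toHyperplane_last {m : ℕ} (y : EuclideanSpace ℝ (Fin m)) :
    toHyperplane y (Fin.last m) = 1 := by
  simp [toHyperplane]

/-- The central projection to the hyperplane where the last coordinate is 1 (which is identified with
`ℝᵐ`). It has a junk value where the last coordinate vanishes. -/
noncomputable def centralProjection {m : ℕ} (x : EuclideanSpace ℝ (Fin (m + 1))) :
    EuclideanSpace ℝ (Fin m) :=
  WithLp.toLp 2 fun i => x i.castSucc / x (Fin.last m)

@[simp]
theorem centralProjection_apply {m : ℕ} (x : EuclideanSpace ℝ (Fin (m + 1))) (i : Fin m) :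
    centralProjection x i = x i.castSucc / x (Fin.last m) := rfl

theorem smul_toHyperplane_centralProjection {m : ℕ} {x : EuclideanSpace ℝ (Fin (m + 1))}
    (hx : x (Fin.last m) ≠ 0) : x (Fin.last m) • toHyperplane (centralProjection x) = x := by
  ext i
  induction i using Fin.lastCases with
  | last => simp
  | cast i => simp [mul_div_cancel₀ _ hx]

theorem centralProjection_smul_toHyperplane {m : ℕ} (y : EuclideanSpace ℝ (Fin m)) {t : ℝ}
    (ht : t ≠ 0) : centralProjection (t • toHyperplane y) = y := by
  ext i
  simp [mul_div_cancel_left₀ _ ht]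

theorem mem_coneOver_toHyperplane {m : ℕ} {Γ : Set (EuclideanSpace ℝ (Fin m))}
    {x : EuclideanSpace ℝ (Fin (m + 1))} :
    x ∈ coneOver (toHyperplane '' Γ) ↔ 0 < x (Fin.last m) ∧ centralProjection x ∈ Γ := by
  constructor
  · rintro ⟨t, ht, _, ⟨y, hy, rfl⟩, rfl⟩
    rw [centralProjection_smul_toHyperplane y ht.ne']
    exact ⟨by simpa using ht, hy⟩
  · rintro ⟨h1, h2⟩
    exact ⟨_, h1, _, ⟨_, h2, rfl⟩, (smul_toHyperplane_centralProjection h1.ne').symm⟩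

theorem toHyperplane_combo {m : ℕ} (x y : EuclideanSpace ℝ (Fin m)) {a b : ℝ} (hab : a + b = 1) :
    toHyperplane (a • x + b • y) = a • toHyperplane x + b • toHyperplane y := by
  ext i
  induction i using Fin.lastCases with
  | last => simp [hab]
  | cast i => simp

theorem smul_toHyperplane_mem_convexHull_coneOver {m : ℕ} {Γ : Set (EuclideanSpace ℝ (Fin m))}
    {y : EuclideanSpace ℝ (Fin m)} (hy : y ∈ convexHull ℝ Γ) {t : ℝ} (ht : 0 < t) :
    t • toHyperplane y ∈ convexHull ℝ (coneOver (toHyperplane '' Γ)) := by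
  have hc : Convex ℝ {y : EuclideanSpace ℝ (Fin m) |
      t • toHyperplane y ∈ convexHull ℝ (coneOver (toHyperplane '' Γ))} := by
    intro x hx y hy a b ha hb hab
    simp only [Set.mem_ofPred_eq] at hx hy ⊢
    rw [toHyperplane_combo x y hab, smul_add, smul_comm t a, smul_comm t b]
    exact convex_convexHull ℝ _ hx hy ha hb hab
  refine convexHull_min (fun y hy => ?_) hc hy
  exact subset_convexHull ℝ _ (show _ ∈ coneOver _ from ⟨t, ht, _, ⟨y, hy, rfl⟩, rfl⟩)

/-- The homogenization `z² F (x / z)` of the defining function `F` of the body, where `z` is the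
last coordinate. It defines the cone. -/
noncomputable def coneFunction {n : ℕ} (E : ℝ → ℝ) (x : EuclideanSpace ℝ (Fin (n + 2))) : ℝ :=
  ‖x‖ ^ 2 - 2 * x (Fin.last _) ^ 2 + x (Fin.last _) ^ 2 * E (x 0 / x (Fin.last _))

theorem coneFunction_eq {n : ℕ} (E : ℝ → ℝ) {x : EuclideanSpace ℝ (Fin (n + 2))}
    (hx : x (Fin.last _) ≠ 0) :
    coneFunction E x = x (Fin.last _) ^ 2 * tableFunction E (centralProjection x) := by
  rw [coneFunction, tableFunction, EuclideanSpace.real_norm_sq_eq, EuclideanSpace.real_norm_sq_eq,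
    Fin.sum_univ_castSucc]
  simp only [centralProjection_apply, Fin.castSucc_zero, div_pow, ← Finset.sum_div]
  field_simp
  ring

/-- The vector with coordinates `x`, `y`, `z` at the first two places and at the last. -/
noncomputable def spatialVector (n : ℕ) (x y z : ℝ) : EuclideanSpace ℝ (Fin (n + 3)) :=
  EuclideanSpace.single 0 x + EuclideanSpace.single 1 y + EuclideanSpace.single (Fin.last _) z

theorem zero_ne_last (n : ℕ) : (0 : Fin (n + 3)) ≠ Fin.last (n + 2) := by
  simp [Fin.ext_iff]

theorem one_ne_last (n : ℕ) : (1 : Fin (n + 3)) ≠ Fin.last (n + 2) := by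
  simp [Fin.ext_iff]

@[simp]
theorem spatialVector_zero (n : ℕ) (x y z : ℝ) : spatialVector n x y z 0 = x := by
  simp [spatialVector]

@[simp]
theorem spatialVector_last (n : ℕ) (x y z : ℝ) : spatialVector n x y z (Fin.last _) = z := by
  simp [spatialVector, (zero_ne_last n).symm, (one_ne_last n).symm]

theorem norm_sq_spatialVector (n : ℕ) (x y z : ℝ) :
    ‖spatialVector n x y z‖ ^ 2 = x ^ 2 + y ^ 2 + z ^ 2 := by
  simp [spatialVector, norm_add_sq_real, inner_add_left, EuclideanSpace.inner_single_left,
    one_ne_last]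

theorem spatialVector_add (n : ℕ) (x y z x' y' z' : ℝ) : spatialVector n x y z +
    spatialVector n x' y' z' = spatialVector n (x + x') (y + y') (z + z') := by
  ext i
  simp only [spatialVector, PiLp.add_apply, PiLp.single_apply]
  split_ifs <;> ring

theorem smul_spatialVector (n : ℕ) (c x y z : ℝ) :
    c • spatialVector n x y z = spatialVector n (c * x) (c * y) (c * z) := by
  ext i
  simp only [spatialVector, PiLp.add_apply, PiLp.smul_apply, PiLp.single_apply, smul_eq_mul]
  split_ifs <;> ring

theorem exists_toHyperplane_eq_spatialVector (n : ℕ) (x y : ℝ) : ∃ q : EuclideanSpace ℝ (Fin (n + 2)),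
    toHyperplane q = spatialVector n x y 1 ∧ q 0 = x ∧ ‖q‖ ^ 2 = x ^ 2 + y ^ 2 := by
  refine ⟨centralProjection (spatialVector n x y 1), ?_, ?_, ?_⟩
  · simpa using smul_toHyperplane_centralProjection (x := spatialVector n x y 1) (by simp)
  · simp
  · have := norm_sq_spatialVector n x y 1
    rw [EuclideanSpace.real_norm_sq_eq, Fin.sum_univ_castSucc, spatialVector_last] at this
    rw [EuclideanSpace.real_norm_sq_eq]
    simp only [centralProjection_apply, spatialVector_last, div_one]
    linarith

namespace IsSmallProfile

variable {n : ℕ} {E : ℝ → ℝ} (hE : IsSmallProfile E)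
include hE

theorem contDiffAt_coneFunction {x : EuclideanSpace ℝ (Fin (n + 2))} (hx : x (Fin.last _) ≠ 0) :
    ContDiffAt ℝ 2 (coneFunction E) x := by
  have hp : ∀ i, ContDiffAt ℝ 2 (fun x : EuclideanSpace ℝ (Fin (n + 2)) => x i) x := fun i =>
    (EuclideanSpace.proj (𝕜 := ℝ) i).contDiff.contDiffAt
  exact ((contDiff_norm_sq ℝ).contDiffAt.sub (contDiffAt_const.mul ((hp _).pow 2))).add
    (((hp _).pow 2).mul (hE.contDiff.contDiffAt.comp x ((hp 0).div (hp _) hx)))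

theorem hasGradientAt_coneFunction {x : EuclideanSpace ℝ (Fin (n + 2))}
    (hx : x (Fin.last _) ≠ 0) : HasGradientAt (coneFunction E)
      ((2 : ℝ) • x + EuclideanSpace.single 0 (x (Fin.last _) * deriv E (x 0 / x (Fin.last _))) +
        EuclideanSpace.single (Fin.last _) (-4 * x (Fin.last _) +
          2 * x (Fin.last _) * E (x 0 / x (Fin.last _)) -
            x 0 * deriv E (x 0 / x (Fin.last _)))) x := by
  rw [hasGradientAt_iff_hasFDerivAt]
  have hp : ∀ i, HasFDerivAt (fun x : EuclideanSpace ℝ (Fin (n + 2)) => x i)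
      (EuclideanSpace.proj (𝕜 := ℝ) i) x := fun i => (EuclideanSpace.proj (𝕜 := ℝ) i).hasFDerivAt
  have h1 := (hasStrictFDerivAt_norm_sq x).hasFDerivAt.sub (((hp (Fin.last _)).pow 2).const_mul 2)
  have h2 := ((hp (Fin.last _)).pow 2).mul ((hE.hasDerivAt _).comp_hasFDerivAt x
    ((hp 0).fun_mul ((hasDerivAt_inv hx).comp_hasFDerivAt x (hp (Fin.last _)))))
  have h3 := h1.add h2
  refine HasFDerivAt.congr_fderiv h3 ?_
  refine ContinuousLinearMap.ext fun v => ?_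
  simp [EuclideanSpace.inner_single_left, ← div_eq_mul_inv]
  field_simp
  ring

theorem mem_interior_convexHull_coneOver {x : EuclideanSpace ℝ (Fin (n + 2))} (hz : 0 < x (Fin.last _))
    (hx : tableFunction E (centralProjection x) < 0) :
    x ∈ interior (convexHull ℝ (coneOver (toHyperplane ''
      {y : EuclideanSpace ℝ (Fin (n + 1)) | tableFunction E y = 0}))) := by
  rw [mem_interior_iff_mem_nhds]
  have hp : Continuous (fun x : EuclideanSpace ℝ (Fin (n + 2)) => x (Fin.last _)) :=
    (EuclideanSpace.proj (𝕜 := ℝ) (Fin.last (n + 1))).continuous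
  have hx' : coneFunction E x < 0 := by
    rw [coneFunction_eq E hz.ne']
    exact mul_neg_of_pos_of_neg (by positivity) hx
  filter_upwards [hp.continuousAt.eventually (lt_mem_nhds hz),
    (hE.contDiffAt_coneFunction hz.ne').continuousAt.eventually (gt_mem_nhds hx')] with w hw hw'
  rw [coneFunction_eq E (ne_of_gt hw)] at hw'
  rw [← smul_toHyperplane_centralProjection (ne_of_gt hw)]
  exact smul_toHyperplane_mem_convexHull_coneOver
    (hE.mem_convexHull_of_tableFunction_neg (neg_of_mul_neg_right hw' (sq_nonneg _))) hw

theorem isC2DefiningFunctionAt_coneFunction {x : EuclideanSpace ℝ (Fin (n + 2))}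
    (hx : x ∈ coneOver (toHyperplane '' {y : EuclideanSpace ℝ (Fin (n + 1)) | tableFunction E y = 0}))
    (hg : gradient (coneFunction E) x ≠ 0) :
    IsC2DefiningFunctionAt (coneOver (toHyperplane ''
      {y : EuclideanSpace ℝ (Fin (n + 1)) | tableFunction E y = 0})) (coneFunction E) x := by
  have hz := (mem_coneOver_toHyperplane.1 hx).1
  have hp : Continuous (fun x : EuclideanSpace ℝ (Fin (n + 2)) => x (Fin.last _)) :=
    (EuclideanSpace.proj (𝕜 := ℝ) (Fin.last (n + 1))).continuous
  refine ⟨hx, hE.contDiffAt_coneFunction hz.ne', hg, ?_⟩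
  filter_upwards [hp.continuousAt.eventually (lt_mem_nhds hz)] with w hw
  rw [mem_coneOver_toHyperplane, coneFunction_eq E (ne_of_gt hw)]
  simp [hw, (ne_of_gt hw : w.ofLp (Fin.last (n + 1)) ≠ 0)]

end IsSmallProfile

/-! ### The trajectory -/

/-- The point of the round cone over the unit circle at the angle `α`. -/
noncomputable def circleVertex (n : ℕ) (α : ℝ) : EuclideanSpace ℝ (Fin (n + 3)) :=
  spatialVector n (Real.sin α) (-Real.cos α) 1

/-- The vector of length `√2`, orthogonal to `circleVertex n α`, that points from this vertex
towards the vertex at the angle `α + 2 β`. -/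
noncomputable def departure (n : ℕ) (α β : ℝ) : EuclideanSpace ℝ (Fin (n + 3)) :=
  spatialVector n (-(radialWeight β * Real.sin α) + 2 * tangentialWeight β * Real.cos α)
    (radialWeight β * Real.cos α + 2 * tangentialWeight β * Real.sin α) (radialWeight β)

/-- The vector of length `√2`, orthogonal to `circleVertex n α`, that points at this vertex
away from the vertex at the angle `α - 2 β`. -/
noncomputable def arrival (n : ℕ) (α β : ℝ) : EuclideanSpace ℝ (Fin (n + 3)) :=
  departure n α (-β)

theorem radialWeight_neg (β : ℝ) : radialWeight (-β) = -radialWeight β := by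
  simp [radialWeight, neg_div]

theorem tangentialWeight_neg (β : ℝ) : tangentialWeight (-β) = tangentialWeight β := by
  simp [tangentialWeight]

section

variable (n : ℕ) {β : ℝ} (hβ : 0 ≤ Real.sin β)
include hβ

theorem circleVertex_add (α : ℝ) : circleVertex n (α + 2 * β) =
    Real.cos (arcAngle β) • circleVertex n α + Real.sin (arcAngle β) • departure n α β := by
  have h := (sqrt_one_add_cos_sq_pos β).ne'
  have hs := Real.sin_sq_add_cos_sq β
  rw [cos_arcAngle, sin_arcAngle hβ, circleVertex, circleVertex, departure, smul_spatialVector,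
    smul_spatialVector, spatialVector_add, Real.sin_add, Real.cos_add, Real.sin_two_mul,
    Real.cos_two_mul, radialWeight, tangentialWeight]
  congr 1
  · field_simp
    linear_combination Real.sin α * hs
  · field_simp
    linear_combination -Real.cos α * hs
  · field_simp
    linear_combination -hs

theorem arrival_add (α : ℝ) : arrival n (α + 2 * β) β =
    -Real.sin (arcAngle β) • circleVertex n α + Real.cos (arcAngle β) • departure n α β := by
  have h := (sqrt_one_add_cos_sq_pos β).ne'
  have hW : √(1 + Real.cos β ^ 2) ^ 2 = 1 + Real.cos β ^ 2 := Real.sq_sqrt (by positivity)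
  have hs := Real.sin_sq_add_cos_sq β
  rw [cos_arcAngle, sin_arcAngle hβ, circleVertex, arrival, departure, departure,
    smul_spatialVector, smul_spatialVector, spatialVector_add, Real.sin_add, Real.cos_add,
    Real.sin_two_mul, Real.cos_two_mul, radialWeight_neg, tangentialWeight_neg, radialWeight,
    tangentialWeight]
  generalize √(1 + Real.cos β ^ 2) = W at *
  congr 1
  · field_simp
    linear_combination Real.sin α * Real.sin β * hW + 2 * Real.cos β * Real.cos α * hs
  · field_simp
    linear_combination -Real.sin β * Real.cos α * hW + 2 * Real.cos β * Real.sin α * hs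
  · field_simp
    linear_combination Real.sin β * hW

end

theorem norm_sq_sin_circleVertex_add_cos_departure (n : ℕ) (θ α β : ℝ) :
    ‖Real.sin θ • circleVertex n α + Real.cos θ • departure n α β‖ ^ 2 = 2 := by
  rw [circleVertex, departure, smul_spatialVector, smul_spatialVector, spatialVector_add,
    norm_sq_spatialVector]
  have h1 := Real.sin_sq_add_cos_sq θ
  have h2 := Real.sin_sq_add_cos_sq α
  have h3 := radialWeight_sq_add β
  generalize radialWeight β = a at *
  generalize tangentialWeight β = b at *
  generalize Real.sin α = s at *
  generalize Real.cos α = c at *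
  linear_combination 2 * h1 + 2 * Real.cos θ ^ 2 * h3 +
    (Real.sin θ ^ 2 - 2 * Real.sin θ * Real.cos θ * a + Real.cos θ ^ 2 * (a ^ 2 + 4 * b ^ 2)) * h2

theorem IsSmallProfile.gradient_coneFunction_smul_circleVertex {E : ℝ → ℝ} (hE : IsSmallProfile E)
    (n : ℕ) {α r : ℝ} (hr : 0 < r) (h0 : E (Real.sin α) = 0) :
    gradient (coneFunction E) (r • circleVertex n α) =
      r • spatialVector n (2 * Real.sin α + deriv E (Real.sin α)) (-2 * Real.cos α)
        (-(2 + deriv E (Real.sin α) * Real.sin α)) := by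
  have h1 : (r • circleVertex n α) (Fin.last _) = r := by simp [circleVertex]
  have h2 : (r • circleVertex n α) 0 = r * Real.sin α := by simp [circleVertex]
  have h3 := (hE.hasGradientAt_coneFunction (x := r • circleVertex n α) (by rw [h1]; exact hr.ne'))
  rw [h1, h2, mul_div_cancel_left₀ _ hr.ne', h0] at h3
  rw [h3.gradient, circleVertex, spatialVector, spatialVector]
  ext i
  simp only [PiLp.add_apply, PiLp.smul_apply, PiLp.single_apply, smul_eq_mul]
  split_ifs <;> ring

/-- The reflection law: for `e` as in `kink_spec`, the jump of the direction at a vertex is a multiple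
of the normal of the cone there, as computed in `gradient_coneFunction_smul_circleVertex`. -/
theorem departure_sub_arrival (n : ℕ) {α β β' e : ℝ} (h : 2 + e * Real.sin α ≠ 0)
    (hb : tangentialWeight β + tangentialWeight β' ≠ 0)
    (he : (2 + e * Real.sin α) * (radialWeight β - radialWeight β') =
      e * Real.cos α * (tangentialWeight β + tangentialWeight β')) :
    departure n α β - arrival n α β' =
      (-(radialWeight β + radialWeight β') / (2 + e * Real.sin α)) •
        spatialVector n (2 * Real.sin α + e) (-2 * Real.cos α) (-(2 + e * Real.sin α)) := by
  have h1 := radialWeight_sq_add β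
  have h2 := radialWeight_sq_add β'
  have h3 := Real.sin_sq_add_cos_sq α
  rw [sub_eq_iff_eq_add, arrival, departure, departure, smul_spatialVector, spatialVector_add,
    radialWeight_neg, tangentialWeight_neg]
  generalize radialWeight β = a at *
  generalize radialWeight β' = a' at *
  generalize tangentialWeight β = b at *
  generalize tangentialWeight β' = b' at *
  -- Both directions have length `√2`, so `(a - a') (a + a') = -2 (b - b') (b + b')`.
  have h4 : 2 * (b - b') * (2 + e * Real.sin α) = -(e * Real.cos α * (a + a')) := by
    refine mul_right_cancel₀ hb ?_
    linear_combination (2 + e * Real.sin α) * (h1 - h2) - (a + a') * he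
  have h5 : -(a + a') / (2 + e * Real.sin α) * (2 + e * Real.sin α) = -(a + a') :=
    div_mul_cancel₀ _ h
  generalize -(a + a') / (2 + e * Real.sin α) = κ at *
  congr 1
  · refine mul_left_cancel₀ h ?_
    linear_combination Real.cos α * h4 - (2 * Real.sin α + e) * h5 - e * (a + a') * h3
  · refine mul_left_cancel₀ h ?_
    linear_combination Real.sin α * h4 + 2 * Real.cos α * h5
  · linear_combination h5

/-- The angle, seen from the apex, swept by the trajectory that starts at the vertex number `N` up to
its `k`-th reflection. -/
noncomputable def sweptAngle (N k : ℕ) : ℝ := ∑ j ∈ Finset.range k, arcAngle (halfStep (N + j))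

theorem sweptAngle_succ (N k : ℕ) :
    sweptAngle N (k + 1) = sweptAngle N k + arcAngle (halfStep (N + k)) :=
  Finset.sum_range_succ _ _

theorem sweptAngle_nonneg (N k : ℕ) : 0 ≤ sweptAngle N k :=
  Finset.sum_nonneg fun _ _ => Real.arccos_nonneg _

theorem sweptAngle_le (N k : ℕ) :
    sweptAngle N k ≤ 3 / 2 * (vertexAngle (N + k) - vertexAngle N) := by
  induction k with
  | zero => simp [sweptAngle]
  | succ k ih =>
    have h1 := arcAngle_le (halfStep_pos (N + k)).le
      (by linarith [halfStep_le (N + k), Real.pi_gt_three])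
    have h2 := halfStep_eq (N + k)
    rw [sweptAngle_succ, ← add_assoc]
    linarith

theorem IsSmallProfile.combo_mem_interior {n : ℕ} {E : ℝ → ℝ} (hE : IsSmallProfile E)
    {q q' : EuclideanSpace ℝ (Fin (n + 1))} (hq : tableFunction E q = 0)
    (hq' : tableFunction E q' = 0) (hne : q ≠ q') {a b : ℝ} (ha : 0 < a) (hb : 0 < b) :
    a • toHyperplane q + b • toHyperplane q' ∈ interior (convexHull ℝ (coneOver (toHyperplane ''
      {y : EuclideanSpace ℝ (Fin (n + 1)) | tableFunction E y = 0}))) := by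
  have hab : 0 < a + b := by positivity
  have h1 : a / (a + b) + b / (a + b) = 1 := by field_simp
  have h2 : a • toHyperplane q + b • toHyperplane q' =
      (a + b) • toHyperplane ((a / (a + b)) • q + (b / (a + b)) • q') := by
    rw [toHyperplane_combo q q' h1, smul_add, smul_smul, smul_smul, mul_div_cancel₀ _ hab.ne',
      mul_div_cancel₀ _ hab.ne']
  rw [h2]
  refine hE.mem_interior_convexHull_coneOver (by simpa using hab) ?_
  rw [centralProjection_smul_toHyperplane _ hab.ne']
  have := hE.strictConvexOn_tableFunction.2 (Set.mem_univ q) (Set.mem_univ q') hne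
    (div_pos ha hab) (div_pos hb hab) h1
  simpa [hq, hq'] using this

/-- The trajectory has vertices `p k` on the rays through `circleVertex`. Unfolded into a plane it is a
straight line at distance `√2` from the apex, so that the point seen at the angle `θ` has distance
`√2 / cos θ` from the apex and is reached at time `√2 * tan θ`. Since `θ` stays below `1 < π / 2`,
the times are bounded. -/
theorem exists_trajectory (n : ℕ) {N : ℕ} {E : ℝ → ℝ} (hE : IsSmallProfile E)
    (h0 : ∀ k, E (Real.sin (vertexAngle (N + k))) = 0)
    (h1 : ∀ k, deriv E (Real.sin (vertexAngle (N + k + 1))) = kink (N + k))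
    (h2 : ∀ k, vertexAngle (N + k) - vertexAngle N ≤ 1 / 2) :
    ∃ (τ : ℕ → ℝ) (p v : ℕ → EuclideanSpace ℝ (Fin (n + 3))),
      IsInfiniteBilliardTrajectory (coneOver (toHyperplane ''
        {y : EuclideanSpace ℝ (Fin (n + 2)) | tableFunction E y = 0})) τ p v ∧
      BddAbove (Set.range τ) := by
  have hθ0 := sweptAngle_nonneg N
  have hθ1 : ∀ k, sweptAngle N k ≤ 1 := fun k => by linarith [sweptAngle_le N k, h2 k]
  have hcos : ∀ k, 0 < Real.cos (sweptAngle N k) := fun k =>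
    Real.cos_pos_of_le_one (abs_le.2 ⟨by linarith [hθ0 k], hθ1 k⟩)
  have hsin : ∀ k, 0 ≤ Real.sin (halfStep k) := fun k =>
    (Real.sin_pos_of_pos_of_le_one (halfStep_pos k) (by linarith [halfStep_le k])).le
  have hstep : ∀ k, vertexAngle (N + (k + 1)) = vertexAngle (N + k) + 2 * halfStep (N + k) :=
    fun k => by rw [halfStep_eq, ← add_assoc]; ring
  have hpi : (1 : ℝ) < Real.pi / 2 := by linarith [Real.pi_gt_three]
  have hs2 : √(2 : ℝ) ^ 2 = 2 := Real.sq_sqrt (by norm_num)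
  have hs2' : √(2 : ℝ) ≠ 0 := by positivity
  have hθmono : ∀ k, sweptAngle N k < sweptAngle N (k + 1) := fun k => by
    rw [sweptAngle_succ]
    linarith [arcAngle_pos (halfStep_pos (N + k))
      (by linarith [halfStep_le (N + k), Real.pi_gt_three])]
  choose q hq1 hq2 hq3 using fun k =>
    exists_toHyperplane_eq_spatialVector n (Real.sin (vertexAngle (N + k)))
      (-Real.cos (vertexAngle (N + k)))
  have hq : ∀ k, toHyperplane (q k) = circleVertex n (vertexAngle (N + k)) := hq1
  have hqF : ∀ k, tableFunction E (q k) = 0 := fun k => by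
    rw [tableFunction, hq3, hq2, h0, neg_sq, Real.sin_sq_add_cos_sq]
    norm_num
  have hqne : ∀ k, q k ≠ q (k + 1) := fun k h => by
    have h3 := halfStep_le_sin_sub_sin (N + k)
    have h4 := congrArg (fun y => y 0) h
    simp only [hq2] at h4
    rw [← add_assoc] at h4
    linarith [halfStep_pos (N + k)]
  let τ : ℕ → ℝ := fun k => √2 * Real.tan (sweptAngle N k)
  let p : ℕ → EuclideanSpace ℝ (Fin (n + 3)) := fun k =>
    (Real.cos (sweptAngle N k))⁻¹ • circleVertex n (vertexAngle (N + k))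
  let v : ℕ → EuclideanSpace ℝ (Fin (n + 3)) := fun k =>
    (√2)⁻¹ • (Real.sin (sweptAngle N k) • circleVertex n (vertexAngle (N + k)) +
      Real.cos (sweptAngle N k) • departure n (vertexAngle (N + k)) (halfStep (N + k)))
  have hmono : StrictMono τ := strictMono_nat_of_lt_succ fun k => by
    have := Real.tan_lt_tan_of_lt_of_lt_pi_div_two (by linarith [hθ0 k])
      (by linarith [hθ1 (k + 1)]) (hθmono k)
    exact mul_lt_mul_of_pos_left this (by positivity)
  have hnorm : ∀ k, ‖v k‖ = 1 := fun k => by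
    have := norm_sq_sin_circleVertex_add_cos_departure n (sweptAngle N k) (vertexAngle (N + k))
      (halfStep (N + k))
    rw [← sq_eq_sq₀ (norm_nonneg _) zero_le_one, norm_smul, mul_pow, this, norm_inv, inv_pow,
      Real.norm_of_nonneg (by positivity), hs2]
    norm_num
  have hmotion : ∀ k, p (k + 1) = p k + (τ (k + 1) - τ k) • v k := fun k => by
    have hc := (hcos k).ne'
    have hc' := (hcos (k + 1)).ne'
    simp only [p, v, τ, Real.tan_eq_sin_div_cos]
    rw [sweptAngle_succ] at hc' ⊢
    rw [hstep, circleVertex_add n (hsin (N + k))]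
    have hs := Real.sin_sq_add_cos_sq (sweptAngle N k)
    rw [Real.cos_add] at hc'
    rw [Real.cos_add, Real.sin_add]
    generalize Real.sin (sweptAngle N k) = s at *
    generalize Real.cos (sweptAngle N k) = c at *
    match_scalars
    · field_simp
      linear_combination -s * Real.sin (arcAngle (halfStep (N + k))) * hs
    · field_simp
      linear_combination -Real.sin (arcAngle (halfStep (N + k))) * hs
  have hmem : ∀ k, p k ∈ coneOver (toHyperplane ''
      {y : EuclideanSpace ℝ (Fin (n + 2)) | tableFunction E y = 0}) := fun k =>
    ⟨_, inv_pos.2 (hcos k), _, ⟨q k, hqF k, rfl⟩, by rw [hq]⟩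
  refine ⟨τ, p, v, ⟨hmem, hmono, hnorm, hmotion, fun k s hs => ?_, fun k => ?_⟩, √2 * Real.tan 1, ?_⟩
  · have hτ : 0 < τ (k + 1) - τ k := sub_pos.2 (hmono k.lt_succ_self)
    have h3 : p k + (s - τ k) • v k =
        ((τ (k + 1) - s) / (τ (k + 1) - τ k)) • p k +
          ((s - τ k) / (τ (k + 1) - τ k)) • p (k + 1) := by
      rw [hmotion k]
      have := hτ.ne'
      match_scalars
      · field_simp
        ring
      · field_simp
    rw [h3]
    simp only [p, ← hq, smul_smul]
    exact hE.combo_mem_interior (hqF k) (hqF (k + 1)) (hqne k)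
      (mul_pos (div_pos (sub_pos.2 hs.2) hτ) (inv_pos.2 (hcos k)))
      (mul_pos (div_pos (sub_pos.2 hs.1) hτ) (inv_pos.2 (hcos (k + 1))))
  · -- The incoming velocity, written in terms of the frame at the vertex that is reached.
    have hv : v k = (√2)⁻¹ • (Real.sin (sweptAngle N (k + 1)) •
          circleVertex n (vertexAngle (N + (k + 1))) + Real.cos (sweptAngle N (k + 1)) •
            arrival n (vertexAngle (N + (k + 1))) (halfStep (N + k))) := by
      simp only [v]
      rw [hstep, circleVertex_add n (hsin (N + k)), arrival_add n (hsin (N + k)), sweptAngle_succ,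
        Real.sin_add, Real.cos_add]
      have hs := Real.sin_sq_add_cos_sq (arcAngle (halfStep (N + k)))
      match_scalars
      · linear_combination -Real.sin (sweptAngle N k) * (√2)⁻¹ * hs
      · linear_combination -Real.cos (sweptAngle N k) * (√2)⁻¹ * hs
    set e := deriv E (Real.sin (vertexAngle (N + (k + 1)))) with he
    have hek : e = kink (N + k) := h1 k
    have hD : 2 + e * Real.sin (vertexAngle (N + (k + 1))) ≠ 0 := by
      have h3 : |e * Real.sin (vertexAngle (N + (k + 1)))| ≤ 1 / 2 * 1 := by
        rw [abs_mul]
        exact mul_le_mul (hE.abs_deriv_le _) (Real.abs_sin_le_one _) (abs_nonneg _) (by norm_num)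
      have := (abs_le.1 h3).1
      intro h
      linarith
    have hl : ∀ k, |halfStep k| ≤ 1 := fun k => by
      rw [abs_of_pos (halfStep_pos k)]
      linarith [halfStep_le k]
    have hjump := departure_sub_arrival n hD
      (add_pos (tangentialWeight_pos (hl (N + (k + 1)))) (tangentialWeight_pos (hl (N + k)))).ne'
      (by rw [hek]; exact kink_spec (N + k))
    have hg := hE.gradient_coneFunction_smul_circleVertex n (inv_pos.2 (hcos (k + 1)))
      (h0 (k + 1))
    rw [← he] at hg
    have ha : 0 < radialWeight (halfStep (N + (k + 1))) + radialWeight (halfStep (N + k)) :=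
      add_pos (radialWeight_pos (halfStep_pos _) (by linarith [halfStep_le (N + (k + 1))]))
        (radialWeight_pos (halfStep_pos _) (by linarith [halfStep_le (N + k)]))
    set c := -(radialWeight (halfStep (N + (k + 1))) + radialWeight (halfStep (N + k))) /
      (2 + e * Real.sin (vertexAngle (N + (k + 1))))
    have hc0 : c ≠ 0 := div_ne_zero (neg_ne_zero.2 ha.ne') hD
    have hdiff : v k - v (k + 1) = (-(√2)⁻¹ * Real.cos (sweptAngle N (k + 1)) * c *
        Real.cos (sweptAngle N (k + 1))) • gradient (coneFunction E) (p (k + 1)) := by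
      have h4 := eq_add_of_sub_eq hjump
      rw [hv, hg]
      simp only [v]
      rw [h4]
      have := (hcos (k + 1)).ne'
      match_scalars
      · ring
      · ring
      · field_simp
    have hunit := mul_ne_zero (mul_ne_zero (mul_ne_zero (neg_ne_zero.2 (inv_ne_zero hs2'))
      (hcos (k + 1)).ne') hc0) (hcos (k + 1)).ne'
    have hg0 : gradient (coneFunction E) (p (k + 1)) ≠ 0 := by
      intro h
      rw [hg, smul_eq_zero] at h
      rcases h with h | h
      · exact inv_ne_zero (hcos (k + 1)).ne' h
      · have := congrArg (fun y => y (Fin.last _)) h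
        simp only [spatialVector_last, PiLp.zero_apply, neg_eq_zero] at this
        exact hD this
    refine ⟨_, hE.isC2DefiningFunctionAt_coneFunction (hmem (k + 1)) hg0, ?_⟩
    have h5 := Submodule.reflection_sub ((hnorm k).trans (hnorm (k + 1)).symm)
    simp only [hdiff, Submodule.span_singleton_smul_eq (isUnit_iff_ne_zero.2 hunit)] at h5
    exact h5.symm
  · rintro _ ⟨k, rfl⟩
    have : Real.tan (sweptAngle N k) ≤ Real.tan 1 :=
      Real.strictMonoOn_tan.monotoneOn ⟨by linarith [hθ0 k], by linarith [hθ1 k]⟩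
        ⟨by linarith, hpi⟩ (hθ1 k)
    exact mul_le_mul_of_nonneg_left this (by positivity)

theorem theorem1 (m : ℕ) (hm : 2 ≤ m) :
    ∃ K : Set (EuclideanSpace ℝ (Fin (m + 1))), IsC2ConvexCone K ∧
      ∃ (τ : ℕ → ℝ) (p v : ℕ → EuclideanSpace ℝ (Fin (m + 1))),
        IsInfiniteBilliardTrajectory K τ p v ∧ BddAbove (Set.range τ) := by
  obtain ⟨n, rfl⟩ := Nat.exists_eq_add_of_le' hm
  obtain ⟨N, E, hE, b0, b1, b2, h0, h1, h2⟩ := exists_profile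
  have hP : IsSmallProfile E := ⟨hE, b0, b1, b2⟩
  exact ⟨_, hP.isC2ConvexCone, exists_trajectory n hP h0 h1 h2⟩
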